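/- Let $S^+(p,n)$ be the set of real symmetric positive semidefinite $n\times n$ matrices of rank $p$, and let $\mathrm{span}(B)$ denote the column space of a matrix $B$. For $R\in SO(n)$ let the magnitude $|R|$ be its geodesic distance to the identity in $SO(n)$, i.e. the infimum of the Frobenius norms $\|\Omega\|_F$ over skew-symmetric $\Omega$ with $\exp\Omega=R$. A rotation acts on $S^+(p,n)$ by $A\mapsto RAR^T$. For positive definite $X,Y$ put $X\# Y=X^{1/2}(X^{-1/2}YX^{-1/2})^{1/2}X^{1/2}$. The Ando mean of two positive semidefinite matrices $A,B$ is the limit of $X_k\# Y_k$ for all sequences of positive definite matrices $X_k,Y_k$ decreasing (in the Loewner order) to $A$ and $B$. For $A_1,A_2\in S^+(p,n)$ whose column spaces have principal angles all smaller than $\pi/2$, the rank-preserving mean $A_1\circ A_2$ is defined as follows. Let the columns of $U_i\in\mathbb R^{n\times p}$ be an orthonormal basis of $\mathrm{span}(A_i)$, let $U_1^TU_2=O_1(\cos\Sigma)O_2^T$ be a singular value decomposition, with $O_1,O_2\in O(p)$ and $\Sigma$ the diagonal matrix of the principal angles, which lie in $[0,\pi/2)$, and let $Y_i=U_iO_i$.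 Let $W=Y_1\cos\frac{\Sigma}{2}+X\sin\frac{\Sigma}{2}$ with $X=(Y_2-Y_1\cos\Sigma)(\sin\Sigma)^{\dagger}$ be the midpoint of the Grassmann geodesic from $Y_1$ to $Y_2$. Then $A_1\circ A_2=W\big((Y_1^TA_1Y_1)\#(Y_2^TA_2Y_2)\big)W^T$. Let $A\in S^+(p,n)$. (1) If $R\in SO(n)$ and $\mathrm{span}(RAR^T)\cap\mathrm{span}(A)=\{0\}$, then the Ando mean of $A$ and $RAR^T$ is the zero matrix. (2) If $0<p<n/2$, then for every $\delta>0$ there is $R\in SO(n)$ with $0<|R|<\delta$ and $\mathrm{span}(RAR^T)\cap\mathrm{span}(A)=\{0\}$. (3) $A\circ RAR^T\to A$ as $|R|\to 0$: for every neighbourhood $V$ of $A$ there is $\delta>0$ such that for every $R\in SO(n)$ with $|R|<\delta$ the mean $A\circ RAR^T$ is defined (the construction above can be carried out), and every admissible choice of $U_1,U_2,O_1,O_2,\Sigma$ gives a value in $V$. -/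

import Mathlib

open scoped Matrix MatrixOrder Topology ENNReal
open Filter

noncomputable section

/-- `S⁺(p,n)`: the real symmetric positive semidefinite `n × n` matrices of rank `p`. -/
def SPlus (p n : ℕ) : Set (Matrix (Fin n) (Fin n) ℝ) :=
  {A | A.PosSemidef ∧ A.rank = p}

/-- The subspace of `ℝⁿ` spanned by the columns of a matrix. -/
def colSpan {n m : ℕ} (A : Matrix (Fin n) (Fin m) ℝ) : Submodule ℝ (Fin n → ℝ) :=
  Submodule.span ℝ (Set.range Aᵀ)

/-- The magnitude of a rotation `R`: its geodesic distance to the identity in `SO(n)` with the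
metric `⟨Ω₁, Ω₂⟩ = tr (Ω₁ᵀ Ω₂)`. Geodesics issued from the identity are `t ↦ exp (t Ω)` with
`Ω` skew-symmetric, so it is the least Frobenius norm of a skew-symmetric logarithm of `R`. -/
def rotationMagnitude {n : ℕ} (R : Matrix (Fin n) (Fin n) ℝ) : ℝ≥0∞ :=
  ⨅ (Ω : Matrix (Fin n) (Fin n) ℝ) (_ : Ωᵀ = -Ω ∧ NormedSpace.exp Ω = R),
    ENNReal.ofReal (Real.sqrt (Ωᵀ * Ω).trace)

/-- Ando's geometric mean `A # B = A^{1/2} (A^{-1/2} B A^{-1/2})^{1/2} A^{1/2}` of two positive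
definite matrices. -/
def geomMean {m : ℕ} (A B : Matrix (Fin m) (Fin m) ℝ) : Matrix (Fin m) (Fin m) ℝ :=
  CFC.sqrt A * CFC.sqrt ((CFC.sqrt A)⁻¹ * B * (CFC.sqrt A)⁻¹) * CFC.sqrt A

/-- A sequence of positive definite matrices that decreases (in the Loewner order) to `A`. -/
def DecreasesTo {n : ℕ} (X : ℕ → Matrix (Fin n) (Fin n) ℝ)
    (A : Matrix (Fin n) (Fin n) ℝ) : Prop :=
  (∀ k, (X k).PosDef) ∧ Antitone X ∧ Tendsto X atTop (𝓝 A)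

/-- `M` is the Ando mean of the positive semidefinite matrices `A` and `B`: the extension of `#`
to the boundary of the cone by continuity from above. -/
def IsAndoMean {n : ℕ} (A B M : Matrix (Fin n) (Fin n) ℝ) : Prop :=
  A.PosSemidef ∧ B.PosSemidef ∧
    ∀ X Y : ℕ → Matrix (Fin n) (Fin n) ℝ, DecreasesTo X A → DecreasesTo Y B →
      Tendsto (fun k => geomMean (X k) (Y k)) atTop (𝓝 M)

/-- The columns of the `n × p` matrix `U` form an orthonormal basis of the column space
of `A`. -/
def IsOrthonormalBasisOfSpan {p n : ℕ} (U : Matrix (Fin n) (Fin p) ℝ)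
    (A : Matrix (Fin n) (Fin n) ℝ) : Prop :=
  Uᵀ * U = 1 ∧ colSpan U = colSpan A

/-- The midpoint `W = Y₁ cos(Σ/2) + X sin(Σ/2)` of the Grassmann geodesic
`t ↦ Y₁ cos(tΣ) + X sin(tΣ)` from `Y₁` to `Y₂`, where `Σ = diag θ` and
`X = (Y₂ - Y₁ cos Σ) (sin Σ)^†` (the inverse in `ℝ` has `0⁻¹ = 0`, so the diagonal matrix with
entries `(sin θ i)⁻¹` is the pseudo-inverse of `sin Σ`; a column of `X` with `θ i = 0` is
multiplied by `sin 0 = 0`, so its value does not matter). -/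
def grassmannMidpoint {p n : ℕ} (Y₁ Y₂ : Matrix (Fin n) (Fin p) ℝ) (θ : Fin p → ℝ) :
    Matrix (Fin n) (Fin p) ℝ :=
  Y₁ * Matrix.diagonal (fun i => Real.cos (θ i / 2)) +
    ((Y₂ - Y₁ * Matrix.diagonal (fun i => Real.cos (θ i))) *
      Matrix.diagonal (fun i => (Real.sin (θ i))⁻¹)) *
      Matrix.diagonal (fun i => Real.sin (θ i / 2))

/-- `M` is a value of the rank-preserving mean `A₁ ∘ A₂` of `A₁, A₂ ∈ S⁺(p,n)`, obtained from some
orthonormal bases `U₁, U₂` of the two column spaces and some singular value decomposition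
`U₁ᵀ U₂ = O₁ (cos Σ) O₂ᵀ` with all principal angles (the diagonal entries `θ i` of `Σ`) smaller
than `π/2`. With `Yᵢ = Uᵢ Oᵢ`, `W` the Riemannian mean of `Y₁` and `Y₂`, and `Rᵢ² = Yᵢᵀ Aᵢ Yᵢ`,
one has `M = W (R₁² # R₂²) Wᵀ`. -/
def IsRankPreservingMean {n : ℕ} (p : ℕ) (A₁ A₂ M : Matrix (Fin n) (Fin n) ℝ) : Prop :=
  A₁ ∈ SPlus p n ∧ A₂ ∈ SPlus p n ∧
    ∃ (U₁ U₂ : Matrix (Fin n) (Fin p) ℝ) (O₁ O₂ : Matrix (Fin p) (Fin p) ℝ) (θ : Fin p → ℝ),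
      IsOrthonormalBasisOfSpan U₁ A₁ ∧ IsOrthonormalBasisOfSpan U₂ A₂ ∧
      O₁ ∈ Matrix.orthogonalGroup (Fin p) ℝ ∧ O₂ ∈ Matrix.orthogonalGroup (Fin p) ℝ ∧
      (∀ i, 0 ≤ θ i ∧ θ i < Real.pi / 2) ∧
      U₁ᵀ * U₂ = O₁ * Matrix.diagonal (fun i => Real.cos (θ i)) * O₂ᵀ ∧
      M = grassmannMidpoint (U₁ * O₁) (U₂ * O₂) θ *
        geomMean ((U₁ * O₁)ᵀ * A₁ * (U₁ * O₁)) ((U₂ * O₂)ᵀ * A₂ * (U₂ * O₂)) *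
        (grassmannMidpoint (U₁ * O₁) (U₂ * O₂) θ)ᵀ

end

/-! (1) Cauchy–Schwarz gives `(x ⬝ᵥ (A # B) y)² ≤ (x ⬝ᵥ A x) (y ⬝ᵥ B y)`
(`dotProduct_geomMean_sq_le`). Along sequences tending to `A` and `B`, the means therefore pair to
zero in the limit with every vector of `ker A` and of `ker B`. For symmetric matrices with
independent column spaces these kernels span everything (`ker_sup_ker_eq_top`), so every entry tends
to zero.

(2) When `2p ≤ n`, the orthogonal complement of the column space contains an orthonormal `p`-frame
`V`. The one-parameter group generated by `J = V Uᵀ - U Vᵀ` carries the frame `U` to `cos t U + sin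
t V` (`exp_smul_mul_eq`), whose span meets that of `U` only in zero once `sin t ≠ 0`. Its magnitude
is at most `t ‖J‖`, hence as small as desired.

(3) The frames `Y₁, Y₂` coming from a singular value decomposition need not vary continuously with
`R`, so continuity is proved by an estimate that does not see them. Both `‖Y₂ - Y₁‖` and `‖W - Y₁‖`
are controlled by the distance between the orthogonal projections `Yᵢ Yᵢᵀ`, which depend only on the
column spaces (`norm_basis_sub_le`, `norm_grassmannMidpoint_sub_le`). The distance of `P # Q` from
`P` is at most `tr P · tr P⁻¹ · ‖Q - P‖` (`norm_geomMean_sub_le`), and that constant is also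
independent of the basis. Comparing `W (P # Q) Wᵀ` with `A = Y₁ P Y₁ᵀ` gives a bound in terms of `R`
alone that vanishes as `R → 1`. The mean exists near `R = 1` because `Uᵀ R U` is then an invertible
contraction (`exists_cos_svd`), and continuity of `exp` turns small magnitude into closeness to `1`.
-/

/-! ### Cauchy–Schwarz inequality for the geometric mean -/

theorem dotProduct_sq_le {m : ℕ} (x y : Fin m → ℝ) : (x ⬝ᵥ y) ^ 2 ≤ (x ⬝ᵥ x) * (y ⬝ᵥ y) := by
  simp only [dotProduct, ← sq]
  exact Finset.sum_mul_sq_le_sq_mul_sq _ _ _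

theorem mulVec_dotProduct_mulVec {m n k : ℕ} (M : Matrix (Fin m) (Fin n) ℝ)
    (N : Matrix (Fin m) (Fin k) ℝ) (x : Fin n → ℝ) (y : Fin k → ℝ) :
    (M *ᵥ x) ⬝ᵥ (N *ᵥ y) = x ⬝ᵥ ((Mᵀ * N) *ᵥ y) := by
  rw [← Matrix.mulVec_mulVec, Matrix.dotProduct_mulVec x Mᵀ, Matrix.vecMul_transpose]

theorem sqrt_transpose {m : ℕ} (A : Matrix (Fin m) (Fin m) ℝ) :
    (CFC.sqrt A)ᵀ = CFC.sqrt A := by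
  rw [← Matrix.conjTranspose_eq_transpose_of_trivial]
  exact (Matrix.nonneg_iff_posSemidef.1 (CFC.sqrt_nonneg A)).isHermitian

theorem isUnit_det_sqrt {m : ℕ} {A : Matrix (Fin m) (Fin m) ℝ} (hA : A.PosDef) :
    IsUnit (CFC.sqrt A).det := by
  have h : CFC.sqrt A * CFC.sqrt A = A := CFC.sqrt_mul_sqrt_self A hA.posSemidef.nonneg
  have h2 := hA.det_pos
  rw [← h, Matrix.det_mul] at h2
  exact isUnit_iff_ne_zero.2 fun h0 => by simp [h0] at h2

theorem posSemidef_sqrt_inv_conj {m : ℕ} (A : Matrix (Fin m) (Fin m) ℝ)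
    {B : Matrix (Fin m) (Fin m) ℝ} (hB : B.PosSemidef) :
    ((CFC.sqrt A)⁻¹ * B * (CFC.sqrt A)⁻¹).PosSemidef := by
  have h := hB.mul_mul_conjTranspose_same (CFC.sqrt A)⁻¹
  rwa [Matrix.conjTranspose_eq_transpose_of_trivial, Matrix.transpose_nonsing_inv,
    sqrt_transpose] at h

theorem geomMean_transpose {m : ℕ} (A B : Matrix (Fin m) (Fin m) ℝ) :
    (geomMean A B)ᵀ = geomMean A B := by
  simp only [geomMean, Matrix.transpose_mul, sqrt_transpose, Matrix.mul_assoc]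

/-- The Cauchy–Schwarz inequality expressing that the block matrix `[[A, A # B], [A # B, B]]` is
positive semidefinite. -/
theorem dotProduct_geomMean_sq_le {m : ℕ} {A B : Matrix (Fin m) (Fin m) ℝ} (hA : A.PosDef)
    (hB : B.PosSemidef) (x y : Fin m → ℝ) :
    (x ⬝ᵥ (geomMean A B *ᵥ y)) ^ 2 ≤ (x ⬝ᵥ (A *ᵥ x)) * (y ⬝ᵥ (B *ᵥ y)) := by
  have hS : CFC.sqrt A * CFC.sqrt A = A := CFC.sqrt_mul_sqrt_self A hA.posSemidef.nonneg
  have hu := isUnit_det_sqrt hA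
  have hC := CFC.sqrt_mul_sqrt_self _ (posSemidef_sqrt_inv_conj A hB).nonneg
  have hCt := sqrt_transpose ((CFC.sqrt A)⁻¹ * B * (CFC.sqrt A)⁻¹)
  have hSt := sqrt_transpose A
  unfold geomMean
  generalize CFC.sqrt ((CFC.sqrt A)⁻¹ * B * (CFC.sqrt A)⁻¹) = C at *
  generalize CFC.sqrt A = S at *
  -- With `S = A^{1/2}` and `A # B = S C S`, the mean is the pairing of `S x` with `C S y`; the two
  -- squared lengths are the forms of `S S = A` and `S C C S = B`.
  have h1 := dotProduct_sq_le (S *ᵥ x) ((C * S) *ᵥ y)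
  rw [mulVec_dotProduct_mulVec, mulVec_dotProduct_mulVec, mulVec_dotProduct_mulVec,
    Matrix.transpose_mul, hSt, hCt, hS] at h1
  have h2 : S * C * (C * S) = B := by
    calc S * C * (C * S) = S * (C * C) * S := by simp only [Matrix.mul_assoc]
      _ = (S * S⁻¹) * B * (S⁻¹ * S) := by rw [hC]; simp only [Matrix.mul_assoc]
      _ = B := by rw [Matrix.mul_nonsing_inv _ hu, Matrix.nonsing_inv_mul _ hu]; simp
  rwa [h2, ← Matrix.mul_assoc] at h1

/-! ### Column spaces, kernels and the vanishing Ando mean -/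

theorem colSpan_eq_range {n m : ℕ} (A : Matrix (Fin n) (Fin m) ℝ) :
    colSpan A = LinearMap.range A.mulVecLin := by
  rw [Matrix.range_mulVecLin]; rfl

theorem mem_colSpan {n m : ℕ} {A : Matrix (Fin n) (Fin m) ℝ} {x : Fin n → ℝ} :
    x ∈ colSpan A ↔ ∃ y, A *ᵥ y = x := by
  rw [colSpan_eq_range]; rfl

/-- For symmetric matrices with independent column spaces the kernels span the whole space. -/
theorem ker_sup_ker_eq_top {n : ℕ} {A B : Matrix (Fin n) (Fin n) ℝ} (hA : Aᵀ = A) (hB : Bᵀ = B)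
    (h : colSpan B ⊓ colSpan A = ⊥) :
    LinearMap.ker A.mulVecLin ⊔ LinearMap.ker B.mulVecLin = ⊤ := by
  -- A functional that vanishes on `ker C` is the pairing with a vector of the range of `Cᵀ = C`. A
  -- functional killing both kernels would thus be represented by a vector in both column spaces.
  have key : ∀ {C : Matrix (Fin n) (Fin n) ℝ}, Cᵀ = C → ∀ f : Module.Dual ℝ (Fin n → ℝ),
      LinearMap.ker C.mulVecLin ≤ LinearMap.ker f → ∃ w ∈ colSpan C, ∀ x, f x = w ⬝ᵥ x := by
    intro C hC f hf
    have hm : f ∈ (LinearMap.ker C.mulVecLin).dualAnnihilator :=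
      (Submodule.mem_dualAnnihilator f).2 fun w hw => hf hw
    rw [← LinearMap.range_dualMap_eq_dualAnnihilator_ker] at hm
    obtain ⟨g, rfl⟩ := hm
    obtain ⟨v, rfl⟩ := (dotProductEquiv ℝ (Fin n)).surjective g
    refine ⟨C *ᵥ v, mem_colSpan.2 ⟨v, rfl⟩, fun x => ?_⟩
    simp only [LinearMap.dualMap_apply, Matrix.mulVecLin_apply, dotProductEquiv_apply_apply]
    rw [Matrix.dotProduct_mulVec, ← Matrix.mulVec_transpose, hC]
  by_contra hne
  obtain ⟨f, hf0, hf⟩ := Submodule.exists_le_ker_of_lt_top _ (lt_top_iff_ne_top.2 hne)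
  obtain ⟨v, hv, hfv⟩ := key hA f (le_sup_left.trans hf)
  obtain ⟨w, hw, hfw⟩ := key hB f (le_sup_right.trans hf)
  have hvw : v = w := dotProduct_eq v w fun x => (hfv x).symm.trans (hfw x)
  have : v ∈ colSpan B ⊓ colSpan A := ⟨hvw ▸ hw, hv⟩
  rw [h, Submodule.mem_bot] at this
  exact hf0 (LinearMap.ext fun x => by simp [hfv, this])

theorem tendsto_dotProduct_mulVec {n : ℕ} {X : ℕ → Matrix (Fin n) (Fin n) ℝ}
    {A : Matrix (Fin n) (Fin n) ℝ} (h : Tendsto X atTop (𝓝 A)) (x y : Fin n → ℝ) :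
    Tendsto (fun k => x ⬝ᵥ (X k *ᵥ y)) atTop (𝓝 (x ⬝ᵥ (A *ᵥ y))) := by
  have hc : Continuous fun M : Matrix (Fin n) (Fin n) ℝ => x ⬝ᵥ (M *ᵥ y) := by fun_prop
  exact (hc.tendsto A).comp h

/-- Each basis vector splits as `a + b` with `A a = 0` and `B b = 0`. One factor of the
Cauchy–Schwarz bound then tends to zero while the other converges. -/
theorem isAndoMean_zero {n : ℕ} {A B : Matrix (Fin n) (Fin n) ℝ} (hA : A.PosSemidef)
    (hB : B.PosSemidef) (h : colSpan B ⊓ colSpan A = ⊥) : IsAndoMean A B 0 := by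
  refine ⟨hA, hB, fun X Y hX hY => ?_⟩
  have tr : ∀ {C : Matrix (Fin n) (Fin n) ℝ}, C.PosSemidef → Cᵀ = C := fun hC => by
    rw [← Matrix.conjTranspose_eq_transpose_of_trivial]; exact hC.isHermitian
  have left : ∀ a b y : Fin n → ℝ, A *ᵥ a = 0 → B *ᵥ b = 0 →
      Tendsto (fun k => (a + b) ⬝ᵥ (geomMean (X k) (Y k) *ᵥ y)) atTop (𝓝 0) := by
    intro a b y ha hb
    have h1 := (tendsto_dotProduct_mulVec hX.2.2 a a).mul (tendsto_dotProduct_mulVec hY.2.2 y y)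
    have h2 := (tendsto_dotProduct_mulVec hX.2.2 y y).mul (tendsto_dotProduct_mulVec hY.2.2 b b)
    rw [ha, dotProduct_zero, zero_mul] at h1
    rw [hb, dotProduct_zero, mul_zero] at h2
    have h3 : Tendsto (fun k => (a ⬝ᵥ (geomMean (X k) (Y k) *ᵥ y)) ^ 2) atTop (𝓝 0) :=
      squeeze_zero (fun k => sq_nonneg _)
        (fun k => dotProduct_geomMean_sq_le (hX.1 k) (hY.1 k).posSemidef a y) h1
    have h4 : Tendsto (fun k => (b ⬝ᵥ (geomMean (X k) (Y k) *ᵥ y)) ^ 2) atTop (𝓝 0) := by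
      refine squeeze_zero (fun k => sq_nonneg _) (fun k => ?_) h2
      -- Symmetry of the mean moves `b` to the second slot, the one bounded by the form of `Y k`.
      rw [Matrix.dotProduct_mulVec, ← Matrix.mulVec_transpose, geomMean_transpose, dotProduct_comm]
      exact dotProduct_geomMean_sq_le (hX.1 k) (hY.1 k).posSemidef y b
    have sq0 : ∀ {u : ℕ → ℝ}, Tendsto (fun k => u k ^ 2) atTop (𝓝 0) → Tendsto u atTop (𝓝 0) :=
      fun hu => (tendsto_zero_iff_abs_tendsto_zero _).2 <| by
        simpa [Function.comp_def, Real.sqrt_sq_eq_abs] using hu.sqrt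
    replace h3 := sq0 h3
    replace h4 := sq0 h4
    simpa [add_dotProduct] using h3.add h4
  refine tendsto_pi_nhds.2 fun i => tendsto_pi_nhds.2 fun j => ?_
  have hi : (Pi.single i 1 : Fin n → ℝ) ∈
      LinearMap.ker A.mulVecLin ⊔ LinearMap.ker B.mulVecLin := by
    rw [ker_sup_ker_eq_top (tr hA) (tr hB) h]; trivial
  obtain ⟨a, ha, b, hb, hab⟩ := Submodule.mem_sup.1 hi
  have := left a b (Pi.single j 1) (by simpa using ha) (by simpa using hb)
  rw [hab] at this
  simpa using this

/-! ### Orthonormal bases of column spaces and the action of rotations -/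

theorem posSemidef_conj {n : ℕ} {A : Matrix (Fin n) (Fin n) ℝ} (hA : A.PosSemidef)
    (R : Matrix (Fin n) (Fin n) ℝ) : (R * A * Rᵀ).PosSemidef := by
  simpa [Matrix.conjTranspose_eq_transpose_of_trivial] using hA.mul_mul_conjTranspose_same R

/-- Every subspace of dimension at least `q` contains `q` orthonormal vectors. -/
theorem exists_orthonormal_columns {n q : ℕ} (S : Submodule ℝ (Fin n → ℝ))
    (hq : q ≤ Module.finrank ℝ S) :
    ∃ U : Matrix (Fin n) (Fin q) ℝ, Uᵀ * U = 1 ∧ colSpan U ≤ S := by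
  let e : EuclideanSpace ℝ (Fin n) ≃ₗ[ℝ] (Fin n → ℝ) := WithLp.linearEquiv 2 ℝ (Fin n → ℝ)
  let T : Submodule ℝ (EuclideanSpace ℝ (Fin n)) := S.comap e.toLinearMap
  have hT : Module.finrank ℝ T = Module.finrank ℝ S := by
    have : T = S.map e.symm.toLinearMap := Submodule.comap_equiv_eq_map_symm e S
    rw [this]
    exact LinearEquiv.finrank_map_eq e.symm S
  obtain ⟨v, hv, hvT⟩ : ∃ v : Fin q → EuclideanSpace ℝ (Fin n),
      Orthonormal ℝ v ∧ ∀ i, v i ∈ T := by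
    let b := stdOrthonormalBasis ℝ T
    have hb := b.orthonormal.comp (Fin.castLE (hT ▸ hq)) (Fin.castLE_injective _)
    exact ⟨_, hb.comp_linearIsometry T.subtypeₗᵢ, fun i => (b (Fin.castLE (hT ▸ hq) i)).2⟩
  refine ⟨Matrix.of fun i j => v j i, ?_, ?_⟩
  · ext i j
    have := orthonormal_iff_ite.1 hv i j
    rw [PiLp.inner_apply] at this
    rw [Matrix.one_apply, ← this, Matrix.mul_apply]
    exact Finset.sum_congr rfl fun k _ => mul_comm _ _
  · rw [colSpan, Submodule.span_le]
    rintro _ ⟨j, rfl⟩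
    exact hvT j

theorem exists_eq_mul {n p q : ℕ} {U : Matrix (Fin n) (Fin p) ℝ} {B : Matrix (Fin n) (Fin q) ℝ}
    (h : colSpan B ≤ colSpan U) : ∃ K : Matrix (Fin p) (Fin q) ℝ, B = U * K := by
  have : ∀ j, ∃ y, U *ᵥ y = Bᵀ j := fun j =>
    mem_colSpan.1 (h (Submodule.subset_span ⟨j, rfl⟩))
  choose y hy using this
  refine ⟨(Matrix.of y)ᵀ, ?_⟩
  ext i j
  exact (congrFun (hy j) i).symm

theorem colSpan_mul_le {n p q : ℕ} (U : Matrix (Fin n) (Fin p) ℝ) (K : Matrix (Fin p) (Fin q) ℝ) :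
    colSpan (U * K) ≤ colSpan U := by
  intro x hx
  obtain ⟨y, rfl⟩ := mem_colSpan.1 hx
  exact mem_colSpan.2 ⟨K *ᵥ y, by rw [Matrix.mulVec_mulVec]⟩

theorem finrank_colSpan {n m : ℕ} (A : Matrix (Fin n) (Fin m) ℝ) :
    Module.finrank ℝ (colSpan A) = A.rank := by
  rw [colSpan_eq_range]; rfl

theorem finrank_colSpan_of_orthonormal {n p : ℕ} {U : Matrix (Fin n) (Fin p) ℝ}
    (hU : Uᵀ * U = 1) : Module.finrank ℝ (colSpan U) = p := by
  rw [finrank_colSpan]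
  apply le_antisymm
  · simpa using U.rank_le_width
  · have h := Matrix.rank_mul_le_right Uᵀ U
    rw [hU, Matrix.rank_one, Fintype.card_fin] at h
    exact h

theorem exists_isOrthonormalBasisOfSpan {p n : ℕ} {A : Matrix (Fin n) (Fin n) ℝ}
    (hA : A.rank = p) : ∃ U : Matrix (Fin n) (Fin p) ℝ, IsOrthonormalBasisOfSpan U A := by
  obtain ⟨U, hU, hle⟩ := exists_orthonormal_columns (q := p) (colSpan A)
    (by rw [finrank_colSpan, hA])
  refine ⟨U, hU, Submodule.eq_of_le_of_finrank_eq hle ?_⟩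
  rw [finrank_colSpan_of_orthonormal hU, finrank_colSpan, hA]

theorem mul_transpose_mul_of_colSpan_le {n p q : ℕ} {U : Matrix (Fin n) (Fin p) ℝ}
    {B : Matrix (Fin n) (Fin q) ℝ} (hU : Uᵀ * U = 1) (h : colSpan B ≤ colSpan U) :
    U * Uᵀ * B = B := by
  obtain ⟨K, rfl⟩ := exists_eq_mul h
  rw [Matrix.mul_assoc, ← Matrix.mul_assoc Uᵀ, hU, Matrix.one_mul]

/-- The orthogonal projection does not depend on the orthonormal basis. -/
theorem mul_transpose_eq_of_colSpan_eq {n p q : ℕ} {U : Matrix (Fin n) (Fin p) ℝ}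
    {U' : Matrix (Fin n) (Fin q) ℝ} (hU : Uᵀ * U = 1) (hU' : U'ᵀ * U' = 1)
    (h : colSpan U = colSpan U') : U * Uᵀ = U' * U'ᵀ := by
  have h1 := mul_transpose_mul_of_colSpan_le hU h.ge
  have h2 := mul_transpose_mul_of_colSpan_le hU' h.le
  have h3 : U * Uᵀ * (U' * U'ᵀ) = U' * U'ᵀ := by rw [← Matrix.mul_assoc, h1]
  have h4 : U' * U'ᵀ * (U * Uᵀ) = U * Uᵀ := by rw [← Matrix.mul_assoc, h2]
  have h5 := congrArg Matrix.transpose h4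
  simp only [Matrix.transpose_mul, Matrix.transpose_transpose] at h5
  rw [← h5, h3]

/-- A unit orthogonal frame of the same size in the orthogonal complement. -/
theorem exists_orthonormal_complement {n p : ℕ} (U : Matrix (Fin n) (Fin p) ℝ)
    (h : 2 * p ≤ n) :
    ∃ V : Matrix (Fin n) (Fin p) ℝ, Vᵀ * V = 1 ∧ Uᵀ * V = 0 := by
  have hr := LinearMap.finrank_range_add_finrank_ker (Uᵀ).mulVecLin
  have h1 : Module.finrank ℝ (LinearMap.range (Uᵀ).mulVecLin) ≤ p := by
    simpa using Submodule.finrank_le (LinearMap.range (Uᵀ).mulVecLin)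
  rw [Module.finrank_fin_fun] at hr
  obtain ⟨V, hV, hle⟩ := exists_orthonormal_columns (q := p)
    (LinearMap.ker (Uᵀ).mulVecLin) (by omega)
  refine ⟨V, hV, ?_⟩
  ext i j
  have : Vᵀ j ∈ LinearMap.ker (Uᵀ).mulVecLin := hle (Submodule.subset_span ⟨j, rfl⟩)
  exact congrFun (LinearMap.mem_ker.1 this) i

theorem colSpan_mul_eq_of_mul_eq_one {n m : ℕ} (A : Matrix (Fin n) (Fin m) ℝ)
    {K L : Matrix (Fin m) (Fin m) ℝ} (h : K * L = 1) : colSpan (A * K) = colSpan A := by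
  refine le_antisymm (colSpan_mul_le A K) ?_
  have := colSpan_mul_le (A * K) L
  rwa [Matrix.mul_assoc, h, Matrix.mul_one] at this

theorem colSpan_mul_le_colSpan_mul {n p q : ℕ} (R : Matrix (Fin n) (Fin n) ℝ)
    {U : Matrix (Fin n) (Fin p) ℝ} {B : Matrix (Fin n) (Fin q) ℝ} (h : colSpan B ≤ colSpan U) :
    colSpan (R * B) ≤ colSpan (R * U) := by
  obtain ⟨K, rfl⟩ := exists_eq_mul h
  rw [← Matrix.mul_assoc]
  exact colSpan_mul_le _ _

theorem colSpan_conj {p n : ℕ} {A R : Matrix (Fin n) (Fin n) ℝ} {U : Matrix (Fin n) (Fin p) ℝ}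
    (hR : R ∈ Matrix.orthogonalGroup (Fin n) ℝ) (h : colSpan U = colSpan A) :
    colSpan (R * U) = colSpan (R * A * Rᵀ) := by
  have h1 : Rᵀ * R = 1 := Matrix.mem_orthogonalGroup_iff' _ _ |>.1 hR
  rw [colSpan_mul_eq_of_mul_eq_one _ h1]
  exact le_antisymm (colSpan_mul_le_colSpan_mul R h.le) (colSpan_mul_le_colSpan_mul R h.ge)

theorem mul_isOrthonormalBasisOfSpan {p n : ℕ} {A R : Matrix (Fin n) (Fin n) ℝ}
    {U : Matrix (Fin n) (Fin p) ℝ} (hR : R ∈ Matrix.orthogonalGroup (Fin n) ℝ)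
    (h : IsOrthonormalBasisOfSpan U A) : IsOrthonormalBasisOfSpan (R * U) (R * A * Rᵀ) := by
  refine ⟨?_, colSpan_conj hR h.2⟩
  have h1 : Rᵀ * R = 1 := Matrix.mem_orthogonalGroup_iff' _ _ |>.1 hR
  rw [Matrix.transpose_mul, Matrix.mul_assoc, ← Matrix.mul_assoc Rᵀ, h1, Matrix.one_mul, h.1]

theorem IsOrthonormalBasisOfSpan.mul_orthogonal {p n : ℕ} {A : Matrix (Fin n) (Fin n) ℝ}
    {U : Matrix (Fin n) (Fin p) ℝ} {O : Matrix (Fin p) (Fin p) ℝ}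
    (h : IsOrthonormalBasisOfSpan U A) (hO : O ∈ Matrix.orthogonalGroup (Fin p) ℝ) :
    IsOrthonormalBasisOfSpan (U * O) A := by
  have h1 : Oᵀ * O = 1 := Matrix.mem_orthogonalGroup_iff' _ _ |>.1 hO
  have h2 : O * Oᵀ = 1 := Matrix.mem_orthogonalGroup_iff _ _ |>.1 hO
  refine ⟨?_, (colSpan_mul_eq_of_mul_eq_one U h2).trans h.2⟩
  rw [Matrix.transpose_mul, Matrix.mul_assoc, ← Matrix.mul_assoc Uᵀ, h.1, Matrix.one_mul, h1]

theorem conj_mem_SPlus {p n : ℕ} {A R : Matrix (Fin n) (Fin n) ℝ} (hA : A ∈ SPlus p n)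
    (hR : R ∈ Matrix.orthogonalGroup (Fin n) ℝ) : R * A * Rᵀ ∈ SPlus p n := by
  refine ⟨posSemidef_conj hA.1 R, ?_⟩
  have h1 : R * Rᵀ = 1 := Matrix.mem_orthogonalGroup_iff _ _ |>.1 hR
  have hu : IsUnit R.det := by
    have := congrArg Matrix.det h1
    rw [Matrix.det_mul, Matrix.det_one] at this
    exact IsUnit.of_mul_eq_one _ this
  rw [Matrix.rank_mul_eq_left_of_isUnit_det _ _ (by rwa [Matrix.det_transpose]),
    Matrix.rank_mul_eq_right_of_isUnit_det _ _ hu]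
  exact hA.2

/-! ### Matrix exponential, rotation magnitude and small rotations -/

section ExpContinuity
attribute [local instance] Matrix.linftyOpNormedRing Matrix.linftyOpNormedAlgebra

theorem matrix_exp_continuous (n : ℕ) :
    Continuous (NormedSpace.exp : Matrix (Fin n) (Fin n) ℝ → Matrix (Fin n) (Fin n) ℝ) :=
  NormedSpace.exp_continuous

theorem hasDerivAt_matrix_exp_smul {n : ℕ} (J : Matrix (Fin n) (Fin n) ℝ) (t : ℝ) :
    HasDerivAt (fun s : ℝ => NormedSpace.exp (s • J)) (NormedSpace.exp (t • J) * J) t :=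
  hasDerivAt_exp_smul_const J t

theorem HasDerivAt.matrix_mul_const_apply {n p : ℕ} {f : ℝ → Matrix (Fin n) (Fin n) ℝ}
    {f' : Matrix (Fin n) (Fin n) ℝ} {t : ℝ} (hf : HasDerivAt f f' t)
    (U : Matrix (Fin n) (Fin p) ℝ) (i : Fin n) (j : Fin p) :
    HasDerivAt (fun s => (f s * U) i j) ((f' * U) i j) t := by
  let l : Matrix (Fin n) (Fin n) ℝ →ₗ[ℝ] ℝ :=
    { toFun := fun M => (M * U) i j
      map_add' := fun M N => by simp [Matrix.add_mul]
      map_smul' := fun c M => by simp }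
  exact (LinearMap.toContinuousLinearMap l).hasFDerivAt.comp_hasDerivAt t hf

end ExpContinuity

section Frobenius
attribute [local instance] Matrix.frobeniusNormedAddCommGroup

theorem frobenius_norm_eq {m n : ℕ} (A : Matrix (Fin m) (Fin n) ℝ) :
    ‖A‖ = Real.sqrt (Aᵀ * A).trace := by
  rw [Matrix.frobenius_norm_def, Real.sqrt_eq_rpow, Matrix.trace, Finset.sum_comm]
  congr 1
  refine Finset.sum_congr rfl fun i _ => ?_
  simp only [Matrix.diag, Matrix.mul_apply, Matrix.transpose_apply]
  refine Finset.sum_congr rfl fun j _ => ?_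
  rw [Real.rpow_two, Real.norm_eq_abs, sq_abs, sq]

/-- A magnitude below `ε` supplies a logarithm of Frobenius norm below `ε`, so continuity of `exp`
at `0` suffices. -/
theorem exists_rotationMagnitude_lt {n : ℕ} {V : Set (Matrix (Fin n) (Fin n) ℝ)} (hV : V ∈ 𝓝 1) :
    ∃ δ : ℝ≥0∞, 0 < δ ∧ ∀ R : Matrix (Fin n) (Fin n) ℝ, rotationMagnitude R < δ → R ∈ V := by
  have h0 : NormedSpace.exp ⁻¹' V ∈ 𝓝 (0 : Matrix (Fin n) (Fin n) ℝ) :=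
    (matrix_exp_continuous n).continuousAt.preimage_mem_nhds (by rwa [NormedSpace.exp_zero])
  obtain ⟨ε, hε, hball⟩ := Metric.mem_nhds_iff.1 h0
  refine ⟨ENNReal.ofReal ε, ENNReal.ofReal_pos.2 hε, fun R hR => ?_⟩
  obtain ⟨Ω, hΩ⟩ := iInf_lt_iff.1 hR
  obtain ⟨⟨_, rfl⟩, hlt⟩ := iInf_lt_iff.1 hΩ
  refine hball ?_
  rw [mem_ball_zero_iff, frobenius_norm_eq]
  exact (ENNReal.ofReal_lt_ofReal_iff hε).1 hlt

end Frobenius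

/-- The infimum is not known to be attained, so positivity is obtained topologically: the matrices
different from `R` form a neighbourhood of `1`. -/
theorem rotationMagnitude_pos {n : ℕ} {R : Matrix (Fin n) (Fin n) ℝ} (hR : R ≠ 1) :
    0 < rotationMagnitude R := by
  obtain ⟨δ, hδ, h⟩ := exists_rotationMagnitude_lt (isOpen_ne.mem_nhds hR.symm)
  by_contra h0
  rw [not_lt, nonpos_iff_eq_zero] at h0
  exact h R (h0 ▸ hδ) rfl

theorem rotationMagnitude_exp_le {n : ℕ} {Ω : Matrix (Fin n) (Fin n) ℝ} (hΩ : Ωᵀ = -Ω) :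
    rotationMagnitude (NormedSpace.exp Ω) ≤ ENNReal.ofReal (Real.sqrt (Ωᵀ * Ω).trace) :=
  iInf₂_le Ω ⟨hΩ, rfl⟩

theorem exp_mem_specialOrthogonalGroup {n : ℕ} {Ω : Matrix (Fin n) (Fin n) ℝ} (hΩ : Ωᵀ = -Ω) :
    NormedSpace.exp Ω ∈ Matrix.specialOrthogonalGroup (Fin n) ℝ := by
  have orth : ∀ {Λ : Matrix (Fin n) (Fin n) ℝ}, Λᵀ = -Λ →
      (NormedSpace.exp Λ)ᵀ * NormedSpace.exp Λ = 1 := by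
    intro Λ hΛ
    rw [← Matrix.exp_transpose, hΛ, Matrix.exp_neg]
    exact Matrix.nonsing_inv_mul _ ((Matrix.isUnit_iff_isUnit_det _).1 (Matrix.isUnit_exp Λ))
  refine Matrix.mem_specialOrthogonalGroup_iff.2
    ⟨(Matrix.mem_orthogonalGroup_iff' _ _).2 (orth hΩ), ?_⟩
  -- Orthogonality alone leaves the sign of the determinant open; writing `exp Ω` as the square of
  -- `exp (Ω/2)` makes it a square equal to `1`.
  have hhalf : ((1 / 2 : ℝ) • Ω)ᵀ = -((1 / 2 : ℝ) • Ω) := by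
    rw [Matrix.transpose_smul, hΩ, smul_neg]
  have h1 := congrArg Matrix.det (orth hhalf)
  have h2 : NormedSpace.exp Ω =
      NormedSpace.exp ((1 / 2 : ℝ) • Ω) * NormedSpace.exp ((1 / 2 : ℝ) • Ω) := by
    rw [← Matrix.exp_add_of_commute _ _ (Commute.refl _), ← add_smul]
    norm_num
  rw [Matrix.det_mul, Matrix.det_transpose, Matrix.det_one] at h1
  rw [h2, Matrix.det_mul, h1]

/-- A skew-symmetric `J` exchanging `U` and `-V` generates the plane rotations. -/
theorem exp_smul_mul_eq {n p : ℕ} {J : Matrix (Fin n) (Fin n) ℝ} {U V : Matrix (Fin n) (Fin p) ℝ}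
    (hU : J * U = V) (hV : J * V = -U) (t : ℝ) :
    NormedSpace.exp (t • J) * U = Real.cos t • U + Real.sin t • V := by
  -- Undoing the expected rotation gives a curve with zero derivative, entry by entry, so it keeps
  -- its value at `s = 0`.
  have key : ∀ s : ℝ, NormedSpace.exp (s • J) *
      (Real.cos s • U - Real.sin s • V) = U := by
    intro s
    ext i j
    have hd : ∀ s : ℝ, HasDerivAt (fun s : ℝ => (NormedSpace.exp (s • J) *
        (Real.cos s • U - Real.sin s • V)) i j) 0 s := by
      intro s
      have h1 := (Real.hasDerivAt_cos s).mul
        ((hasDerivAt_matrix_exp_smul J s).matrix_mul_const_apply U i j)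
      have h2 := (Real.hasDerivAt_sin s).mul
        ((hasDerivAt_matrix_exp_smul J s).matrix_mul_const_apply V i j)
      have h3 := h1.sub h2
      rw [Matrix.mul_assoc, hU, Matrix.mul_assoc, hV] at h3
      refine (h3.congr_deriv ?_).congr_of_eventuallyEq (Eventually.of_forall fun r => ?_)
      · simp
        ring
      · simp [Matrix.mul_sub]
    have hc := is_const_of_deriv_eq_zero (fun s => (hd s).differentiableAt)
      (fun s => (hd s).deriv) s 0
    simpa using hc
  have h1 := key (-t)
  rw [Real.cos_neg, Real.sin_neg, neg_smul, neg_smul, sub_neg_eq_add, Matrix.exp_neg] at h1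
  have hu := (Matrix.isUnit_iff_isUnit_det _).1 (Matrix.isUnit_exp (t • J))
  rw [← h1, ← Matrix.mul_assoc, Matrix.mul_nonsing_inv _ hu, Matrix.one_mul, h1]

theorem exists_rotation_disjoint {p n : ℕ} {A : Matrix (Fin n) (Fin n) ℝ} (hA : A ∈ SPlus p n)
    (hp : 0 < p) (hpn : 2 * p ≤ n) {δ : ℝ≥0∞} (hδ : 0 < δ) :
    ∃ R ∈ Matrix.specialOrthogonalGroup (Fin n) ℝ,
      0 < rotationMagnitude R ∧ rotationMagnitude R < δ ∧
        colSpan (R * A * Rᵀ) ⊓ colSpan A = ⊥ := by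
  obtain ⟨U, hU, hUA⟩ := exists_isOrthonormalBasisOfSpan hA.2
  obtain ⟨V, hV, hUV⟩ := exists_orthonormal_complement U hpn
  have hVU : Vᵀ * U = 0 := by
    have := congrArg Matrix.transpose hUV
    simpa using this
  set J : Matrix (Fin n) (Fin n) ℝ := V * Uᵀ - U * Vᵀ with hJdef
  have hJ : Jᵀ = -J := by simp [hJdef]
  have hJU : J * U = V := by
    rw [hJdef, Matrix.sub_mul, Matrix.mul_assoc, Matrix.mul_assoc, hU, hVU]; simp
  have hJV : J * V = -U := by
    rw [hJdef, Matrix.sub_mul, Matrix.mul_assoc, Matrix.mul_assoc, hV, hUV]; simp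
  set c := Real.sqrt (Jᵀ * J).trace
  -- The bound `t < 1 < π` keeps `sin t` nonzero.
  obtain ⟨t, ht0, ht1, htδ⟩ : ∃ t : ℝ, 0 < t ∧ t < 1 ∧ ENNReal.ofReal (t * c) < δ := by
    have hc : Tendsto (fun t : ℝ => ENNReal.ofReal (t * c)) (𝓝[>] 0) (𝓝 0) := by
      have : Continuous fun t : ℝ => ENNReal.ofReal (t * c) :=
        ENNReal.continuous_ofReal.comp (continuous_id.mul continuous_const)
      simpa using (this.tendsto 0).mono_left nhdsWithin_le_nhds
    obtain ⟨t, h1, h2⟩ := ((hc.eventually (gt_mem_nhds hδ)).and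
      (Ioo_mem_nhdsGT (zero_lt_one' ℝ))).exists
    exact ⟨t, h2.1, h2.2, h1⟩
  have htJ : (t • J)ᵀ = -(t • J) := by rw [Matrix.transpose_smul, hJ, smul_neg]
  have hR := exp_mem_specialOrthogonalGroup htJ
  have hsin : Real.sin t ≠ 0 :=
    (Real.sin_pos_of_pos_of_lt_pi ht0 (by linarith [Real.pi_gt_three])).ne'
  have hdisj : colSpan (NormedSpace.exp (t • J) * A * (NormedSpace.exp (t • J))ᵀ) ⊓ colSpan A
      = ⊥ := by
    rw [← colSpan_conj (Matrix.mem_specialOrthogonalGroup_iff.1 hR).1 hUA, ← hUA,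
      exp_smul_mul_eq hJU hJV, eq_bot_iff]
    rintro x ⟨hx1, hx2⟩
    obtain ⟨y, rfl⟩ := mem_colSpan.1 hx1
    obtain ⟨z, hz⟩ := mem_colSpan.1 hx2
    -- Applying `Vᵀ` kills the `U` components and leaves `sin t • y = 0`.
    have h := congrArg (Vᵀ *ᵥ ·) hz
    simp only [Matrix.mulVec_mulVec, hVU, Matrix.mul_add, Matrix.mul_smul, hV, smul_zero,
      zero_add, Matrix.zero_mulVec, Matrix.smul_mulVec, Matrix.one_mulVec] at h
    have hy : y = 0 := (smul_eq_zero.1 h.symm).resolve_left hsin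
    simp [hy]
  refine ⟨_, hR, rotationMagnitude_pos ?_, lt_of_le_of_lt (rotationMagnitude_exp_le htJ) ?_, hdisj⟩
  -- For `R = 1` the intersection would be the column space of `A` itself, of dimension `p > 0`.
  · intro h1
    rw [h1, Matrix.one_mul, Matrix.transpose_one, Matrix.mul_one, inf_idem] at hdisj
    have := finrank_colSpan A
    rw [hdisj, finrank_bot, hA.2] at this
    omega
  · have : Real.sqrt ((t • J)ᵀ * (t • J)).trace = t * c := by
      rw [Matrix.transpose_smul, Matrix.smul_mul, Matrix.mul_smul, smul_smul, Matrix.trace_smul,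
        smul_eq_mul, Real.sqrt_mul (mul_self_nonneg t), Real.sqrt_mul_self ht0.le]
    rwa [this]

/-! ### Compressions to the column space and principal angles -/

/-- A symmetric matrix is injective on its range: if `v = A z` and `A v = 0`, then `v ⬝ᵥ v = z ⬝ᵥ A
v = 0`. -/
theorem posDef_compression {p n : ℕ} {A : Matrix (Fin n) (Fin n) ℝ} (hA : A.PosSemidef)
    {Y : Matrix (Fin n) (Fin p) ℝ} (hY : IsOrthonormalBasisOfSpan Y A) : (Yᵀ * A * Y).PosDef := by
  have hAt : Aᵀ = A := by
    rw [← Matrix.conjTranspose_eq_transpose_of_trivial]; exact hA.isHermitian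
  have hP : (Yᵀ * A * Y).PosSemidef := by
    simpa [Matrix.conjTranspose_eq_transpose_of_trivial] using hA.conjTranspose_mul_mul_same Y
  refine Matrix.PosDef.of_dotProduct_mulVec_pos hP.isHermitian fun y hy => ?_
  refine lt_of_le_of_ne (hP.dotProduct_mulVec_nonneg y) fun h0 => hy ?_
  have h1 : star (Y *ᵥ y) ⬝ᵥ (A *ᵥ (Y *ᵥ y)) = 0 := by
    rw [h0, star_trivial, star_trivial, Matrix.mulVec_mulVec, mulVec_dotProduct_mulVec,
      Matrix.mul_assoc]
  rw [hA.dotProduct_mulVec_zero_iff] at h1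
  obtain ⟨z, hz⟩ := mem_colSpan.1 (hY.2 ▸ mem_colSpan.2 ⟨y, rfl⟩ : Y *ᵥ y ∈ colSpan A)
  have h2 : Y *ᵥ y = 0 := by
    rw [← hz] at h1 ⊢
    rw [← dotProduct_self_eq_zero, mulVec_dotProduct_mulVec, hAt, ← Matrix.mulVec_mulVec, h1,
      dotProduct_zero]
  rw [← Matrix.one_mulVec y, ← hY.1, ← Matrix.mulVec_mulVec, h2, Matrix.mulVec_zero]

/-- The trace condition number of the compression of `A` to its column space does not depend on the
orthonormal basis. -/
theorem trace_compression_eq {p n : ℕ} {A : Matrix (Fin n) (Fin n) ℝ}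
    {U Y : Matrix (Fin n) (Fin p) ℝ} (hU : IsOrthonormalBasisOfSpan U A)
    (hY : IsOrthonormalBasisOfSpan Y A) :
    (Yᵀ * A * Y).trace = (Uᵀ * A * U).trace ∧ (Yᵀ * A * Y)⁻¹.trace = (Uᵀ * A * U)⁻¹.trace := by
  obtain ⟨K, rfl⟩ := exists_eq_mul (hY.2.trans hU.2.symm).le
  have hK : Kᵀ * K = 1 := by
    have := hY.1
    rwa [Matrix.transpose_mul, Matrix.mul_assoc, ← Matrix.mul_assoc Uᵀ, hU.1, Matrix.one_mul] at this
  have hK' : K * Kᵀ = 1 := mul_eq_one_comm.1 hK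
  have h : (U * K)ᵀ * A * (U * K) = Kᵀ * (Uᵀ * A * U) * K := by
    simp only [Matrix.transpose_mul, Matrix.mul_assoc]
  rw [h, Matrix.mul_inv_rev, Matrix.mul_inv_rev, Matrix.inv_eq_left_inv hK,
    Matrix.inv_eq_left_inv hK']
  constructor
  · rw [Matrix.trace_mul_cycle, hK', Matrix.one_mul]
  · rw [← Matrix.mul_assoc, Matrix.trace_mul_cycle, hK', Matrix.one_mul]

/-- Singular value decomposition of an invertible contraction, with the singular values written
as cosines of angles in `[0, π/2)`. -/
theorem exists_cos_svd {p : ℕ} {N : Matrix (Fin p) (Fin p) ℝ} (hdet : N.det ≠ 0)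
    (hN : (1 - Nᵀ * N).PosSemidef) :
    ∃ (O₁ O₂ : Matrix (Fin p) (Fin p) ℝ) (θ : Fin p → ℝ),
      O₁ ∈ Matrix.orthogonalGroup (Fin p) ℝ ∧ O₂ ∈ Matrix.orthogonalGroup (Fin p) ℝ ∧
      (∀ i, 0 ≤ θ i ∧ θ i < Real.pi / 2) ∧
      N = O₁ * Matrix.diagonal (fun i => Real.cos (θ i)) * O₂ᵀ := by
  have hpsd : (Nᵀ * N).PosSemidef := by
    simpa [Matrix.conjTranspose_eq_transpose_of_trivial] using
      Matrix.posSemidef_conjTranspose_mul_self N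
  have hpd : (Nᵀ * N).PosDef := hpsd.posDef_iff_det_ne_zero.2 <| by
    rw [Matrix.det_mul, Matrix.det_transpose]; exact mul_ne_zero hdet hdet
  have hspec := hpsd.isHermitian.spectral_theorem
  have hpos := hpd.eigenvalues_pos
  obtain ⟨V, l, hV, hl, hspec⟩ : ∃ (V : Matrix (Fin p) (Fin p) ℝ) (l : Fin p → ℝ),
      Vᵀ * V = 1 ∧ (∀ i, 0 < l i) ∧ Nᵀ * N = V * Matrix.diagonal l * Vᵀ := by
    refine ⟨hpsd.isHermitian.eigenvectorUnitary, hpsd.isHermitian.eigenvalues, ?_, hpos, ?_⟩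
    · exact (Matrix.mem_orthogonalGroup_iff' _ _).1 hpsd.isHermitian.eigenvectorUnitary.2
    · conv_lhs => rw [hspec]
      rw [Unitary.conjStarAlgAut_apply]
      rfl
  have hV' : V * Vᵀ = 1 := mul_eq_one_comm.1 hV
  have hdiag : Vᵀ * (Nᵀ * N) * V = Matrix.diagonal l := by
    rw [hspec, Matrix.mul_assoc, Matrix.mul_assoc, Matrix.mul_assoc, hV, Matrix.mul_one,
      ← Matrix.mul_assoc, hV, Matrix.one_mul]
  have hle : ∀ i, l i ≤ 1 := by
    intro i
    have h1 := (hN.conjTranspose_mul_mul_same V).diag_nonneg (i := i)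
    rw [Matrix.conjTranspose_eq_transpose_of_trivial, Matrix.mul_sub, Matrix.sub_mul,
      Matrix.mul_one, hV, hdiag] at h1
    simpa using h1
  have hs : ∀ i, 0 < Real.sqrt (l i) := fun i => Real.sqrt_pos.2 (hl i)
  have hcos : ∀ i, Real.cos (Real.arccos (Real.sqrt (l i))) = Real.sqrt (l i) := fun i =>
    Real.cos_arccos (by linarith [hs i]) (Real.sqrt_le_one.2 (hle i))
  -- Invertibility makes every `l i` positive, so normalising the columns of `N V` already yields a
  -- full orthogonal factor. The same positivity keeps the angles strictly below `π/2`.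
  refine ⟨N * V * Matrix.diagonal (fun i => (Real.sqrt (l i))⁻¹), V,
    fun i => Real.arccos (Real.sqrt (l i)), (Matrix.mem_orthogonalGroup_iff' _ _).2 ?_,
    (Matrix.mem_orthogonalGroup_iff' _ _).2 hV,
    fun i => ⟨Real.arccos_nonneg _, Real.arccos_lt_pi_div_two.2 (hs i)⟩, ?_⟩
  · have : (N * V * Matrix.diagonal (fun i => (Real.sqrt (l i))⁻¹))ᵀ *
        (N * V * Matrix.diagonal (fun i => (Real.sqrt (l i))⁻¹)) =
        Matrix.diagonal (fun i => (Real.sqrt (l i))⁻¹) * (Vᵀ * (Nᵀ * N) * V) *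
        Matrix.diagonal (fun i => (Real.sqrt (l i))⁻¹) := by
      simp only [Matrix.transpose_mul, Matrix.diagonal_transpose, Matrix.mul_assoc]
    rw [this, hdiag, Matrix.diagonal_mul_diagonal, Matrix.diagonal_mul_diagonal,
      ← Matrix.diagonal_one]
    congr 1
    funext i
    have h1 := Real.mul_self_sqrt (hl i).le
    have h2 := (hs i).ne'
    field_simp
    rw [sq, h1]
  · simp only [hcos]
    rw [Matrix.mul_assoc (N * V), Matrix.diagonal_mul_diagonal]
    simp only [inv_mul_cancel₀ (hs _).ne', Matrix.diagonal_one, Matrix.mul_one]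
    rw [Matrix.mul_assoc, hV', Matrix.mul_one]

theorem exists_isRankPreservingMean {p n : ℕ} {A R : Matrix (Fin n) (Fin n) ℝ}
    {U : Matrix (Fin n) (Fin p) ℝ} (hA : A ∈ SPlus p n) (hU : IsOrthonormalBasisOfSpan U A)
    (hR : R ∈ Matrix.orthogonalGroup (Fin n) ℝ) (hdet : (Uᵀ * (R * U)).det ≠ 0) :
    ∃ M, IsRankPreservingMean p A (R * A * Rᵀ) M := by
  have hRU := mul_isOrthonormalBasisOfSpan hR hU
  -- This is the Gram matrix of `(1 - U Uᵀ) R U`, the component of the rotated frame orthogonal to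
  -- the original span.
  have hN : (1 - (Uᵀ * (R * U))ᵀ * (Uᵀ * (R * U))).PosSemidef := by
    have h1 := Matrix.posSemidef_conjTranspose_mul_self ((1 - U * Uᵀ) * (R * U))
    rw [Matrix.conjTranspose_eq_transpose_of_trivial] at h1
    convert h1 using 1
    have h2 : (1 - U * Uᵀ)ᵀ * (1 - U * Uᵀ) = 1 - U * Uᵀ := by
      have : U * Uᵀ * (U * Uᵀ) = U * Uᵀ := by
        rw [← Matrix.mul_assoc, mul_transpose_mul_of_colSpan_le hU.1 le_rfl]
      simp only [Matrix.transpose_sub, Matrix.transpose_one, Matrix.transpose_mul,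
        Matrix.transpose_transpose, Matrix.mul_sub, Matrix.sub_mul, Matrix.one_mul, Matrix.mul_one,
        this]
      abel
    rw [Matrix.transpose_mul (1 - U * Uᵀ), Matrix.mul_assoc, ← Matrix.mul_assoc (1 - U * Uᵀ)ᵀ, h2,
      Matrix.sub_mul, Matrix.mul_sub, Matrix.one_mul, hRU.1, Matrix.transpose_mul Uᵀ,
      Matrix.transpose_transpose]
    simp only [Matrix.mul_assoc]
  obtain ⟨O₁, O₂, θ, h1, h2, h3, h4⟩ := exists_cos_svd hdet hN
  exact ⟨_, hA, conj_mem_SPlus hA hR, U, R * U, O₁, O₂, θ, hU, hRU, h1, h2, h3, h4, rfl⟩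

/-! ### Frobenius-norm estimates for `#` and the Grassmann midpoint -/

section Frobenius
attribute [local instance] Matrix.frobeniusNormedAddCommGroup

theorem frobenius_norm_sq {m n : ℕ} (A : Matrix (Fin m) (Fin n) ℝ) :
    ‖A‖ ^ 2 = (Aᵀ * A).trace := by
  have h := (Matrix.posSemidef_conjTranspose_mul_self A).trace_nonneg
  rw [Matrix.conjTranspose_eq_transpose_of_trivial] at h
  rw [frobenius_norm_eq, Real.sq_sqrt h]

theorem frobenius_norm_diagonal_sq {n : ℕ} (d : Fin n → ℝ) :
    ‖Matrix.diagonal d‖ ^ 2 = ∑ i, d i ^ 2 := by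
  rw [frobenius_norm_sq, Matrix.diagonal_transpose, Matrix.diagonal_mul_diagonal,
    Matrix.trace_diagonal]
  simp only [sq]

theorem frobenius_norm_of_orthonormal {n p : ℕ} {Y : Matrix (Fin n) (Fin p) ℝ}
    (hY : Yᵀ * Y = 1) : ‖Y‖ = Real.sqrt p := by
  rw [frobenius_norm_eq, hY, Matrix.trace_one, Fintype.card_fin]

theorem norm_mul_mul_sub_le {k l m n : ℕ} (A₁ A₂ : Matrix (Fin k) (Fin l) ℝ)
    (B₁ B₂ : Matrix (Fin l) (Fin m) ℝ) (C₁ C₂ : Matrix (Fin m) (Fin n) ℝ) :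
    ‖A₁ * B₁ * C₁ - A₂ * B₂ * C₂‖ ≤
      ‖A₁ - A₂‖ * ‖B₁‖ * ‖C₁‖ + ‖A₂‖ * ‖B₁ - B₂‖ * ‖C₁‖ + ‖A₂‖ * ‖B₂‖ * ‖C₁ - C₂‖ := by
  have h : A₁ * B₁ * C₁ - A₂ * B₂ * C₂ =
      (A₁ - A₂) * B₁ * C₁ + A₂ * (B₁ - B₂) * C₁ + A₂ * B₂ * (C₁ - C₂) := by
    simp only [Matrix.sub_mul, Matrix.mul_sub]; abel
  have h3 : ∀ (A : Matrix (Fin k) (Fin l) ℝ) (B : Matrix (Fin l) (Fin m) ℝ)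
      (C : Matrix (Fin m) (Fin n) ℝ), ‖A * B * C‖ ≤ ‖A‖ * ‖B‖ * ‖C‖ := fun A B C =>
    (Matrix.frobenius_norm_mul _ _).trans
      (mul_le_mul_of_nonneg_right (Matrix.frobenius_norm_mul _ _) (norm_nonneg _))
  rw [h]
  exact (norm_add₃_le).trans (add_le_add_three (h3 _ _ _) (h3 _ _ _) (h3 _ _ _))

/-- `#` is Lipschitz in its second argument on the diagonal. -/
theorem norm_geomMean_sub_le {m : ℕ} {P Q : Matrix (Fin m) (Fin m) ℝ} (hP : P.PosDef)
    (hQ : Q.PosSemidef) : ‖geomMean P Q - P‖ ≤ P.trace * P⁻¹.trace * ‖Q - P‖ := by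
  have hS : CFC.sqrt P * CFC.sqrt P = P := CFC.sqrt_mul_sqrt_self P hP.posSemidef.nonneg
  have hu := isUnit_det_sqrt hP
  have hC := CFC.sqrt_mul_sqrt_self _ (posSemidef_sqrt_inv_conj P hQ).nonneg
  have hCp : (CFC.sqrt ((CFC.sqrt P)⁻¹ * Q * (CFC.sqrt P)⁻¹)).PosSemidef :=
    Matrix.nonneg_iff_posSemidef.1 (CFC.sqrt_nonneg _)
  have hCt := sqrt_transpose ((CFC.sqrt P)⁻¹ * Q * (CFC.sqrt P)⁻¹)
  have hSt := sqrt_transpose P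
  unfold geomMean
  generalize CFC.sqrt ((CFC.sqrt P)⁻¹ * Q * (CFC.sqrt P)⁻¹) = C at *
  generalize CFC.sqrt P = S at *
  have hTS := Matrix.nonsing_inv_mul _ hu
  have hST := Matrix.mul_nonsing_inv _ hu
  have hTt : (S⁻¹)ᵀ = S⁻¹ := by rw [Matrix.transpose_nonsing_inv, hSt]
  have hnS : ‖S‖ ^ 2 = P.trace := by rw [frobenius_norm_sq, hSt, hS]
  have hnT : ‖S⁻¹‖ ^ 2 = P⁻¹.trace := by
    rw [frobenius_norm_sq, hTt, ← Matrix.mul_inv_rev, hS]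
  have hE : C * C - 1 = S⁻¹ * (Q - P) * S⁻¹ := by
    rw [hC, Matrix.mul_sub, Matrix.sub_mul, ← hS, ← Matrix.mul_assoc, hTS, Matrix.one_mul, hST]
  -- Since `C` is positive semidefinite, `(C² - 1)² - (C - 1)² = (C - 1)(C² + 2C)(C - 1)` has
  -- nonnegative trace.
  have hDE : ‖C - 1‖ ≤ ‖C * C - 1‖ := by
    refine le_of_sq_le_sq ?_ (norm_nonneg _)
    rw [frobenius_norm_sq, frobenius_norm_sq, ← sub_nonneg, ← Matrix.trace_sub]
    have h1 := Matrix.posSemidef_conjTranspose_mul_self (C * (C - 1))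
    have h2 := hCp.conjTranspose_mul_mul_same (C - 1)
    rw [Matrix.conjTranspose_eq_transpose_of_trivial] at h1 h2
    have h3 := ((h1.add h2).add h2).trace_nonneg
    refine h3.trans_eq (congrArg Matrix.trace ?_)
    simp only [Matrix.transpose_sub, Matrix.transpose_mul, Matrix.transpose_one, hCt]
    noncomm_ring
  have hSD : S * C * S - P = S * (C - 1) * S := by
    rw [Matrix.mul_sub, Matrix.sub_mul, Matrix.mul_one, hS]
  have h3 : ∀ A B C : Matrix (Fin m) (Fin m) ℝ, ‖A * B * C‖ ≤ ‖A‖ * ‖B‖ * ‖C‖ := fun A B C =>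
    (Matrix.frobenius_norm_mul _ _).trans
      (mul_le_mul_of_nonneg_right (Matrix.frobenius_norm_mul _ _) (norm_nonneg _))
  calc ‖S * C * S - P‖ ≤ ‖S‖ * ‖C - 1‖ * ‖S‖ := by rw [hSD]; exact h3 _ _ _
    _ ≤ ‖S‖ * (‖S⁻¹‖ * ‖Q - P‖ * ‖S⁻¹‖) * ‖S‖ := by
      gcongr
      exact hDE.trans (hE ▸ h3 _ _ _)
    _ = P.trace * P⁻¹.trace * ‖Q - P‖ := by rw [← hnS, ← hnT]; ring

section PrincipalAngles

variable {p n : ℕ} {Y₁ Y₂ : Matrix (Fin n) (Fin p) ℝ} {θ : Fin p → ℝ}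

theorem norm_projection_sub_sq (h₁ : Y₁ᵀ * Y₁ = 1) (h₂ : Y₂ᵀ * Y₂ = 1)
    (h : Y₁ᵀ * Y₂ = Matrix.diagonal (fun i => Real.cos (θ i))) :
    ‖Y₂ * Y₂ᵀ - Y₁ * Y₁ᵀ‖ ^ 2 = ∑ i, 2 * Real.sin (θ i) ^ 2 := by
  have h' : Y₂ᵀ * Y₁ = Matrix.diagonal (fun i => Real.cos (θ i)) := by
    have := congrArg Matrix.transpose h
    simpa using this
  have e : ∀ (X Y : Matrix (Fin n) (Fin p) ℝ),
      (X * Xᵀ * (Y * Yᵀ)).trace = ((Xᵀ * Y) * (Yᵀ * X)).trace := fun X Y => by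
    rw [Matrix.mul_assoc, Matrix.trace_mul_comm]
    simp only [Matrix.mul_assoc]
  rw [frobenius_norm_sq]
  simp only [Matrix.transpose_sub, Matrix.transpose_mul, Matrix.transpose_transpose,
    Matrix.mul_sub, Matrix.sub_mul, Matrix.trace_sub, e, h, h', h₁, h₂,
    Matrix.diagonal_mul_diagonal, Matrix.one_mul, Matrix.trace_one, Fintype.card_fin,
    Matrix.trace_diagonal]
  simp only [Real.sin_sq, mul_sub, Finset.sum_sub_distrib, ← Finset.mul_sum, ← sq]
  simp
  ring

theorem norm_basis_sub_sq (h₁ : Y₁ᵀ * Y₁ = 1) (h₂ : Y₂ᵀ * Y₂ = 1)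
    (h : Y₁ᵀ * Y₂ = Matrix.diagonal (fun i => Real.cos (θ i))) :
    ‖Y₂ - Y₁‖ ^ 2 = ∑ i, 2 * (1 - Real.cos (θ i)) := by
  have h' : Y₂ᵀ * Y₁ = Matrix.diagonal (fun i => Real.cos (θ i)) := by
    have := congrArg Matrix.transpose h
    simpa using this
  rw [frobenius_norm_sq]
  simp only [Matrix.transpose_sub, Matrix.mul_sub, Matrix.sub_mul, Matrix.trace_sub, h, h', h₁, h₂,
    Matrix.trace_one, Fintype.card_fin, Matrix.trace_diagonal, Finset.sum_sub_distrib,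
    ← Finset.mul_sum]
  simp
  ring

theorem one_sub_cos_le_sin_sq {x : ℝ} (hx : 0 ≤ x ∧ x < Real.pi / 2) :
    1 - Real.cos x ≤ Real.sin x ^ 2 := by
  have h0 := Real.cos_nonneg_of_mem_Icc ⟨by linarith [Real.pi_pos], hx.2.le⟩
  rw [Real.sin_sq]
  nlinarith [Real.cos_le_one x]

/-- The squares of the two sides are `∑ 2 (1 - cos θ i)` and `∑ 2 sin² θ i`, compared termwise. The
right side depends only on the two subspaces, which frees later bounds from the choice of frames. -/
theorem norm_basis_sub_le (h₁ : Y₁ᵀ * Y₁ = 1) (h₂ : Y₂ᵀ * Y₂ = 1)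
    (h : Y₁ᵀ * Y₂ = Matrix.diagonal (fun i => Real.cos (θ i)))
    (hθ : ∀ i, 0 ≤ θ i ∧ θ i < Real.pi / 2) : ‖Y₂ - Y₁‖ ≤ ‖Y₂ * Y₂ᵀ - Y₁ * Y₁ᵀ‖ := by
  refine le_of_sq_le_sq ?_ (norm_nonneg _)
  rw [norm_basis_sub_sq h₁ h₂ h, norm_projection_sub_sq h₁ h₂ h]
  exact Finset.sum_le_sum fun i _ => by linarith [one_sub_cos_le_sin_sq (hθ i)]

theorem norm_diagonal_le_norm_projection_sub (h₁ : Y₁ᵀ * Y₁ = 1) (h₂ : Y₂ᵀ * Y₂ = 1)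
    (h : Y₁ᵀ * Y₂ = Matrix.diagonal (fun i => Real.cos (θ i)))
    (hθ : ∀ i, 0 ≤ θ i ∧ θ i < Real.pi / 2) {d : Fin p → ℝ}
    (hd : ∀ i, |d i| ≤ 1 - Real.cos (θ i)) :
    ‖Matrix.diagonal d‖ ≤ ‖Y₂ * Y₂ᵀ - Y₁ * Y₁ᵀ‖ := by
  refine le_of_sq_le_sq ?_ (norm_nonneg _)
  rw [frobenius_norm_diagonal_sq, norm_projection_sub_sq h₁ h₂ h]
  refine Finset.sum_le_sum fun i _ => ?_
  have h0 := Real.cos_nonneg_of_mem_Icc ⟨by linarith [Real.pi_pos, (hθ i).1], (hθ i).2.le⟩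
  rw [← sq_abs]
  nlinarith [one_sub_cos_le_sin_sq (hθ i), hd i, abs_nonneg (d i), Real.cos_le_one (θ i)]

/-- Sine is monotone on `[0, π/2]`; at `x = 0` the convention `0⁻¹ = 0` makes the product zero. -/
theorem abs_sin_half_mul_inv_sin_le {x : ℝ} (hx : 0 ≤ x ∧ x < Real.pi / 2) :
    |(Real.sin x)⁻¹ * Real.sin (x / 2)| ≤ 1 := by
  have hpi := Real.pi_pos
  have h1 : 0 ≤ Real.sin (x / 2) := Real.sin_nonneg_of_nonneg_of_le_pi (by linarith) (by linarith)
  have h2 : Real.sin (x / 2) ≤ Real.sin x :=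
    Real.sin_le_sin_of_le_of_le_pi_div_two (by linarith) hx.2.le (by linarith)
  rw [abs_of_nonneg (mul_nonneg (inv_nonneg.2 (h1.trans h2)) h1), inv_mul_eq_div]
  exact div_le_one_of_le₀ h2 (h1.trans h2)

theorem norm_grassmannMidpoint_sub_le (h₁ : Y₁ᵀ * Y₁ = 1) (h₂ : Y₂ᵀ * Y₂ = 1)
    (h : Y₁ᵀ * Y₂ = Matrix.diagonal (fun i => Real.cos (θ i)))
    (hθ : ∀ i, 0 ≤ θ i ∧ θ i < Real.pi / 2) :
    ‖grassmannMidpoint Y₁ Y₂ θ - Y₁‖ ≤ 3 * Real.sqrt p * ‖Y₂ * Y₂ᵀ - Y₁ * Y₁ᵀ‖ := by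
  set b : Fin p → ℝ := fun i => (Real.sin (θ i))⁻¹ * Real.sin (θ i / 2) with hb
  have hb1 : ∀ i, |b i| ≤ 1 := fun i => abs_sin_half_mul_inv_sin_le (hθ i)
  -- The factor `b`, the quotient of `sin (θ/2)` by `sin θ`, is only bounded. Smallness comes from
  -- `Y₂ - Y₁` and from the two diagonals dominated by `1 - cos θ`; the three terms give the
  -- constant `3`.
  have e : grassmannMidpoint Y₁ Y₂ θ - Y₁ =
      Y₁ * Matrix.diagonal (fun i => Real.cos (θ i / 2) - 1) + (Y₂ - Y₁) * Matrix.diagonal b +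
        Y₁ * Matrix.diagonal (fun i => (1 - Real.cos (θ i)) * b i) := by
    rw [grassmannMidpoint]
    ext i j
    simp only [Matrix.sub_apply, Matrix.add_apply, Matrix.mul_diagonal, hb]
    ring
  have hY : ‖Y₁‖ = Real.sqrt p := frobenius_norm_of_orthonormal h₁
  have d1 : ‖Matrix.diagonal (fun i => Real.cos (θ i / 2) - 1)‖ ≤ ‖Y₂ * Y₂ᵀ - Y₁ * Y₁ᵀ‖ := by
    refine norm_diagonal_le_norm_projection_sub h₁ h₂ h hθ fun i => ?_
    have : Real.cos (θ i) ≤ Real.cos (θ i / 2) := Real.cos_le_cos_of_nonneg_of_le_pi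
      (by linarith [(hθ i).1]) (by linarith [(hθ i).2, Real.pi_pos]) (by linarith [(hθ i).1])
    rw [abs_sub_comm, abs_of_nonneg (by linarith [Real.cos_le_one (θ i / 2)])]
    linarith
  have d2 : ‖Matrix.diagonal (fun i => (1 - Real.cos (θ i)) * b i)‖ ≤
      ‖Y₂ * Y₂ᵀ - Y₁ * Y₁ᵀ‖ := by
    refine norm_diagonal_le_norm_projection_sub h₁ h₂ h hθ fun i => ?_
    have h0 : 0 ≤ 1 - Real.cos (θ i) := by linarith [Real.cos_le_one (θ i)]
    rw [abs_mul, abs_of_nonneg h0]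
    exact mul_le_of_le_one_right h0 (hb1 i)
  have d3 : ‖Matrix.diagonal b‖ ≤ Real.sqrt p := by
    refine Real.le_sqrt_of_sq_le ?_
    rw [frobenius_norm_diagonal_sq]
    calc ∑ i, b i ^ 2 ≤ ∑ _i : Fin p, (1 : ℝ) :=
          Finset.sum_le_sum fun i _ => (sq_le_one_iff_abs_le_one _).2 (hb1 i)
      _ = p := by simp
  have d4 := norm_basis_sub_le h₁ h₂ h hθ
  rw [e]
  refine (norm_add₃_le).trans ?_
  calc _ ≤ ‖Y₁‖ * ‖Matrix.diagonal (fun i => Real.cos (θ i / 2) - 1)‖ +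
        ‖Y₂ - Y₁‖ * ‖Matrix.diagonal b‖ +
        ‖Y₁‖ * ‖Matrix.diagonal (fun i => (1 - Real.cos (θ i)) * b i)‖ :=
        add_le_add_three (Matrix.frobenius_norm_mul _ _) (Matrix.frobenius_norm_mul _ _)
          (Matrix.frobenius_norm_mul _ _)
    _ ≤ Real.sqrt p * ‖Y₂ * Y₂ᵀ - Y₁ * Y₁ᵀ‖ + ‖Y₂ * Y₂ᵀ - Y₁ * Y₁ᵀ‖ * Real.sqrt p +
        Real.sqrt p * ‖Y₂ * Y₂ᵀ - Y₁ * Y₁ᵀ‖ := by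
        rw [hY]; gcongr
    _ = _ := by ring

end PrincipalAngles

end Frobenius

/-! ### Convergence of the rank-preserving mean -/

section Frobenius
attribute [local instance] Matrix.frobeniusNormedAddCommGroup

theorem norm_compression_sub_le {p n : ℕ} {A B : Matrix (Fin n) (Fin n) ℝ}
    {Y₁ Y₂ : Matrix (Fin n) (Fin p) ℝ} (h₁ : Y₁ᵀ * Y₁ = 1) (h₂ : Y₂ᵀ * Y₂ = 1) {e : ℝ}
    (he : ‖Y₂ - Y₁‖ ≤ e) :
    ‖Y₂ᵀ * B * Y₂ - Y₁ᵀ * A * Y₁‖ ≤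
      e * (‖A‖ + ‖B - A‖) * √p + √p * ‖B - A‖ * √p + √p * ‖A‖ * e := by
  have n₁ := frobenius_norm_of_orthonormal h₁
  have n₂ := frobenius_norm_of_orthonormal h₂
  have he0 := (norm_nonneg _).trans he
  have hB : ‖B‖ ≤ ‖A‖ + ‖B - A‖ := by
    have := norm_add_le A (B - A)
    rwa [add_sub_cancel] at this
  refine (norm_mul_mul_sub_le _ _ _ _ _ _).trans ?_
  rw [← Matrix.transpose_sub, Matrix.frobenius_norm_transpose, Matrix.frobenius_norm_transpose,
    n₁, n₂]
  gcongr

/-- A bound for the distance from `A` to a rank-preserving mean of `A` and `B`, where `α` bounds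
`A`, `k` is the trace condition number of `A` on its column space, `e` is the distance of the
projections on the column spaces and `d` is the distance of `A` and `B`. -/
def meanErrorBound (s α k e d : ℝ) : ℝ :=
  3 * s * e * (s * α * s + k * (e * (α + d) * s + s * d * s + s * α * e)) * (s + 3 * s * e) +
    s * (k * (e * (α + d) * s + s * d * s + s * α * e)) * (s + 3 * s * e) +
    s * (s * α * s) * (3 * s * e)

/-- The right side involves one fixed basis `U` and not the frames that define `M`, so a single
estimate covers all admissible choices. -/
theorem norm_rankPreservingMean_sub_le {p n : ℕ} {A R M : Matrix (Fin n) (Fin n) ℝ}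
    {U : Matrix (Fin n) (Fin p) ℝ} (hU : IsOrthonormalBasisOfSpan U A)
    (hR : R ∈ Matrix.orthogonalGroup (Fin n) ℝ)
    (hM : IsRankPreservingMean p A (R * A * Rᵀ) M) :
    ‖M - A‖ ≤ meanErrorBound √p ‖A‖ ((Uᵀ * A * U).trace * (Uᵀ * A * U)⁻¹.trace)
      ‖R * U * (R * U)ᵀ - U * Uᵀ‖ ‖R * A * Rᵀ - A‖ := by
  obtain ⟨hA, hB, U₁, U₂, O₁, O₂, θ, hU₁, hU₂, hO₁, hO₂, hθ, hsvd, rfl⟩ := hM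
  have hY₁ := hU₁.mul_orthogonal hO₁
  have hY₂ := hU₂.mul_orthogonal hO₂
  have hRU := mul_isOrthonormalBasisOfSpan hR hU
  have hcos : (U₁ * O₁)ᵀ * (U₂ * O₂) = Matrix.diagonal (fun i => Real.cos (θ i)) := by
    have e₁ : O₁ᵀ * O₁ = 1 := (Matrix.mem_orthogonalGroup_iff' _ _).1 hO₁
    have e₂ : O₂ᵀ * O₂ = 1 := (Matrix.mem_orthogonalGroup_iff' _ _).1 hO₂
    calc (U₁ * O₁)ᵀ * (U₂ * O₂) = O₁ᵀ * (U₁ᵀ * U₂) * O₂ := by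
          simp only [Matrix.transpose_mul, Matrix.mul_assoc]
      _ = (O₁ᵀ * O₁) * Matrix.diagonal (fun i => Real.cos (θ i)) * (O₂ᵀ * O₂) := by
          rw [hsvd]; simp only [Matrix.mul_assoc]
      _ = _ := by rw [e₁, e₂, Matrix.one_mul, Matrix.mul_one]
  rw [mul_transpose_eq_of_colSpan_eq hU.1 hY₁.1 (hU.2.trans hY₁.2.symm),
    mul_transpose_eq_of_colSpan_eq hRU.1 hY₂.1 (hRU.2.trans hY₂.2.symm)]
  obtain ⟨ht, ht'⟩ := trace_compression_eq hU hY₁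
  rw [← ht, ← ht']
  generalize U₁ * O₁ = Y₁ at *
  generalize U₂ * O₂ = Y₂ at *
  generalize hBdef : R * A * Rᵀ = B at *
  have hP := posDef_compression hA.1 hY₁
  have hQ := posDef_compression hB.1 hY₂
  have n₁ := frobenius_norm_of_orthonormal hY₁.1
  have hk : 0 ≤ (Y₁ᵀ * A * Y₁).trace * (Y₁ᵀ * A * Y₁)⁻¹.trace :=
    mul_nonneg hP.posSemidef.trace_nonneg hP.inv.posSemidef.trace_nonneg
  have hPn : ‖Y₁ᵀ * A * Y₁‖ ≤ √p * ‖A‖ * √p := by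
    refine (Matrix.frobenius_norm_mul _ _).trans ?_
    refine (mul_le_mul_of_nonneg_right (Matrix.frobenius_norm_mul _ _) (norm_nonneg _)).trans ?_
    rw [Matrix.frobenius_norm_transpose, n₁]
  have hG := norm_geomMean_sub_le hP hQ.posSemidef
  have hq := norm_compression_sub_le (A := A) (B := B) hY₁.1 hY₂.1
    (norm_basis_sub_le hY₁.1 hY₂.1 hcos hθ)
  have hW := norm_grassmannMidpoint_sub_le hY₁.1 hY₂.1 hcos hθ
  -- The projection `Y₁ Y₁ᵀ` fixes the range of `A`, which makes `A` a product of the same shape as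
  -- the mean, ready for factor-by-factor comparison.
  have hA' : A = Y₁ * (Y₁ᵀ * A * Y₁) * Y₁ᵀ := by
    have hAt : Aᵀ = A := by
      rw [← Matrix.conjTranspose_eq_transpose_of_trivial]; exact hA.1.isHermitian
    have h1 := mul_transpose_mul_of_colSpan_le hY₁.1 hY₁.2.ge
    have h2 := congrArg Matrix.transpose h1
    simp only [Matrix.transpose_mul, Matrix.transpose_transpose, hAt] at h2
    calc A = A * (Y₁ * Y₁ᵀ) := h2.symm
      _ = Y₁ * Y₁ᵀ * A * (Y₁ * Y₁ᵀ) := by rw [h1]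
      _ = _ := by simp only [Matrix.mul_assoc]
  have hGP := hG.trans (mul_le_mul_of_nonneg_left hq hk)
  have hGn := (norm_le_norm_add_norm_sub' (geomMean (Y₁ᵀ * A * Y₁) (Y₂ᵀ * B * Y₂))
    (Y₁ᵀ * A * Y₁)).trans (add_le_add hPn hGP)
  have hWn := (norm_le_norm_add_norm_sub' (grassmannMidpoint Y₁ Y₂ θ) Y₁).trans
    (add_le_add n₁.le hW)
  generalize geomMean (Y₁ᵀ * A * Y₁) (Y₂ᵀ * B * Y₂) = G at *
  generalize grassmannMidpoint Y₁ Y₂ θ = W at *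
  have hfin := norm_mul_mul_sub_le W Y₁ G (Y₁ᵀ * A * Y₁) Wᵀ Y₁ᵀ
  rw [← hA', ← Matrix.transpose_sub, Matrix.frobenius_norm_transpose,
    Matrix.frobenius_norm_transpose, n₁] at hfin
  refine hfin.trans ?_
  unfold meanErrorBound
  have hs := Real.sqrt_nonneg (p : ℝ)
  have hq0 := (norm_nonneg _).trans hGP
  have hw0 := (norm_nonneg _).trans hW
  have hp0 := (norm_nonneg _).trans hPn
  refine add_le_add_three ?_ ?_ ?_
  · exact mul_le_mul (mul_le_mul hW hGn (norm_nonneg _) hw0) hWn (norm_nonneg _)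
      (mul_nonneg hw0 (add_nonneg hp0 hq0))
  · exact mul_le_mul (mul_le_mul_of_nonneg_left hGP hs) hWn (norm_nonneg _) (mul_nonneg hs hq0)
  · exact mul_le_mul (mul_le_mul_of_nonneg_left hPn hs) hW (norm_nonneg _) (mul_nonneg hs hp0)

/-- Every summand of the expanded bound contains a factor `e` or `d`, and both vanish continuously
at `R = 1`. -/
theorem tendsto_meanErrorBound {p n : ℕ} (A : Matrix (Fin n) (Fin n) ℝ)
    (U : Matrix (Fin n) (Fin p) ℝ) (s α k : ℝ) :
    Tendsto (fun R : Matrix (Fin n) (Fin n) ℝ =>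
      meanErrorBound s α k ‖R * U * (R * U)ᵀ - U * Uᵀ‖ ‖R * A * Rᵀ - A‖) (𝓝 1) (𝓝 0) := by
  have h1 : Continuous fun R : Matrix (Fin n) (Fin n) ℝ => R * U * (R * U)ᵀ - U * Uᵀ := by
    fun_prop
  have h2 : Continuous fun R : Matrix (Fin n) (Fin n) ℝ => R * A * Rᵀ - A := by fun_prop
  have h1' := h1.norm
  have h2' := h2.norm
  have h3 : Continuous fun R : Matrix (Fin n) (Fin n) ℝ =>
      meanErrorBound s α k ‖R * U * (R * U)ᵀ - U * Uᵀ‖ ‖R * A * Rᵀ - A‖ := by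
    unfold meanErrorBound
    fun_prop
  have h4 := h3.tendsto 1
  have h5 : meanErrorBound s α k ‖(1 : Matrix (Fin n) (Fin n) ℝ) * U *
      ((1 : Matrix (Fin n) (Fin n) ℝ) * U)ᵀ - U * Uᵀ‖
      ‖(1 : Matrix (Fin n) (Fin n) ℝ) * A * (1 : Matrix (Fin n) (Fin n) ℝ)ᵀ - A‖ = 0 := by
    simp [meanErrorBound]
  rwa [h5] at h4

theorem exists_rotationMagnitude_rankPreservingMean_mem {p n : ℕ}
    {A : Matrix (Fin n) (Fin n) ℝ} (hA : A ∈ SPlus p n) {V : Set (Matrix (Fin n) (Fin n) ℝ)}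
    (hV : V ∈ 𝓝 A) :
    ∃ δ : ℝ≥0∞, 0 < δ ∧ ∀ R ∈ Matrix.specialOrthogonalGroup (Fin n) ℝ, rotationMagnitude R < δ →
      (∃ M, IsRankPreservingMean p A (R * A * Rᵀ) M) ∧
        ∀ M, IsRankPreservingMean p A (R * A * Rᵀ) M → M ∈ V := by
  obtain ⟨U, hU⟩ := exists_isOrthonormalBasisOfSpan hA.2
  obtain ⟨ε, hε, hball⟩ := Metric.mem_nhds_iff.1 hV
  have hdet : ∀ᶠ R : Matrix (Fin n) (Fin n) ℝ in 𝓝 1, (Uᵀ * (R * U)).det ≠ 0 := by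
    have hc : Continuous fun R : Matrix (Fin n) (Fin n) ℝ => (Uᵀ * (R * U)).det := by fun_prop
    exact hc.continuousAt.eventually_ne (by rw [Matrix.one_mul, hU.1, Matrix.det_one]; simp)
  have hbound := (tendsto_meanErrorBound A U √p ‖A‖
    ((Uᵀ * A * U).trace * (Uᵀ * A * U)⁻¹.trace)).eventually (gt_mem_nhds hε)
  obtain ⟨δ, hδ, h⟩ := exists_rotationMagnitude_lt (hdet.and hbound)
  refine ⟨δ, hδ, fun R hR hlt => ?_⟩
  have hR' := (Matrix.mem_specialOrthogonalGroup_iff.1 hR).1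
  refine ⟨exists_isRankPreservingMean hA hU hR' (h R hlt).1, fun M hM => hball ?_⟩
  rw [mem_ball_iff_norm]
  exact (norm_rankPreservingMean_sub_le hU hR' hM).trans_lt (h R hlt).2

end Frobenius

theorem proposition7 (p n : ℕ) (A : Matrix (Fin n) (Fin n) ℝ) (hA : A ∈ SPlus p n) :
    (∀ R ∈ Matrix.specialOrthogonalGroup (Fin n) ℝ,
        colSpan (R * A * Rᵀ) ⊓ colSpan A = ⊥ → IsAndoMean A (R * A * Rᵀ) 0) ∧
    (0 < p → (p : ℝ) < (n : ℝ) / 2 → ∀ δ : ℝ≥0∞, 0 < δ →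
        ∃ R ∈ Matrix.specialOrthogonalGroup (Fin n) ℝ,
          0 < rotationMagnitude R ∧ rotationMagnitude R < δ ∧
            colSpan (R * A * Rᵀ) ⊓ colSpan A = ⊥) ∧
    (∀ V ∈ 𝓝 A, ∃ δ : ℝ≥0∞, 0 < δ ∧
        ∀ R ∈ Matrix.specialOrthogonalGroup (Fin n) ℝ, rotationMagnitude R < δ →
          (∃ M, IsRankPreservingMean p A (R * A * Rᵀ) M) ∧
            ∀ M, IsRankPreservingMean p A (R * A * Rᵀ) M → M ∈ V) := by
  refine ⟨fun R _ h => isAndoMean_zero hA.1 (posSemidef_conj hA.1 R) h, fun hp hpn δ hδ => ?_,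
    fun V hV => exists_rotationMagnitude_rankPreservingMean_mem hA hV⟩
  have hpn' : 2 * p ≤ n := by
    have : ((2 * p : ℕ) : ℝ) ≤ n := by push_cast; linarith
    exact_mod_cast this
  exact exists_rotation_disjoint hA hp hpn' hδ
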